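/- **Setting.** Let $A\in\mathbb R^{n\times n}$, $B\in\mathbb R^{n\times 1}$, $C\in\mathbb R^{n\times l}$, $\chi(s)=C^{T}(sI_n-A)^{-1}B$, and let $\mathcal G$ be a digraph without self-loops on the vertices $1,\dots,N$, all of whose arcs have weight $1$. In an arc $(i,j)$ the vertex $j$ is called the parent, or neighbour, of $i$; $\mathcal N_i$ is the set of neighbours of $i$, and $L=\mathrm{diag}(\mathcal A\mathbf 1_N)-\mathcal A$ is the Laplace matrix of $\mathcal G$, where $\mathcal A$ is its adjacency matrix. Consider the $N$ agents $$\dot x_i(t)=Ax_i(t)+Bu_i(t),\qquad y_i(t)=C^{T}x_i(t),\qquad i=1,\dots,N,$$ with states $x_i(t)\in\mathbb R^n$, and for $g\in\mathbb R^l$ and gains $k_i>0$ the static controller $$u_i(t)=-k_i\,g^{T}\sum_{j\in\mathcal N_i}\bigl(y_i(t)-y_j(t)\bigr),\qquad i=1,\dots,N.$$ **Assumptions.** - (A1) $g\in\mathbb R^l$ is such that $g^{T}\chi(s)$ is hyper-minimum-phase: its numerator $g^{T}C^{T}\mathrm{adj}(sI_n-A)B$ (over the denominator $\det(sI_n-A)$)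 has degree $n-1$ and positive coefficients, and all its complex roots have negative real part. - (A2) $\mathcal G$ has a directed spanning tree: for some vertex $\rho$ (the root) there is a set of arcs of $\mathcal G$ in which $\rho$ has no parent, every other vertex has exactly one parent, and there is a path from every vertex to $\rho$. **Notation.** Put $$\varkappa_0=\sup_{\omega}\ \mathrm{Re}\Bigl(-\bigl(g^{T}\chi(\mathfrak i\omega)\bigr)^{-1}\Bigr),$$ the supremum being over the real $\omega$ such that $\mathfrak i\omega$ is not an eigenvalue of $A$. For a real square matrix $M$ let $r(M)$ be the minimum of the real parts of the nonzero (complex) eigenvalues of $M$. Let $v(M)$ denote the left eigenvector of $M$ for the eigenvalue $0$ scaled so that $v(M)^{T}\mathbf 1_N=1$. **Theorem.** Let (A1) and (A2) hold. Let $k>0$ and $k_1',\dots,k_N'>0$ satisfy $$\sum_{i=1}^N (k_i')^2=1,\qquad k>\frac{\varkappa_0}{r(K'L)},\qquad K'=\mathrm{diag}(k_1',\dots,k_N')$$ (for $N=1$, where $K'L=0$ has no nonzero eigenvalue, the last inequality is read as $k>0$). Then the vector $v(K'L)$ exists and is unique, and with the gains $k_i=k\cdot k_i'$ every trajectory of the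 closed-loop network on $[0,\infty)$ satisfies $$\lim_{t\to\infty}\bigl(x_i(t)-x_j(t)\bigr)=0,\qquad i,j=1,\dots,N,$$ and $$\lim_{t\to\infty}\bigl(x_i(t)-c(t)\bigr)=0,\quad i=1,\dots,N,\qquad c(t)=\exp(At)\,\bigl(v(K'L)^{T}\otimes I_n\bigr)\,x(0),$$ where $x(0)=\mathrm{col}(x_1(0),\dots,x_N(0))$. -/

import Mathlib

open Filter Topology

noncomputable section

namespace Consensus

/-! ### Linear agents, transfer function, passification constant -/

/-- The real matrix `M` with its entries viewed as complex numbers. -/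
abbrev toComplex {m p : Type*} (M : Matrix m p ℝ) : Matrix m p ℂ :=
  M.map (fun a => (a : ℂ))

/-- The scalar transfer function `gᵀ χ(s) = gᵀ Cᵀ (s I - A)⁻¹ B`; it is meaningful at every `s`
that is not an eigenvalue of `A`. -/
def transfer {n l : ℕ} (A : Matrix (Fin n) (Fin n) ℝ) (B : Fin n → ℝ)
    (C : Matrix (Fin n) (Fin l) ℝ) (g : Fin l → ℝ) (s : ℂ) : ℂ :=
  (fun i => (g i : ℂ)) ⬝ᵥ
    ((toComplex C).transpose.mulVec
      ((s • (1 : Matrix (Fin n) (Fin n) ℂ) - toComplex A)⁻¹.mulVec (fun i => (B i : ℂ))))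

/-- The numerator `gᵀ Cᵀ adj(s I - A) B` of `gᵀ χ(s)`, whose denominator is the characteristic
polynomial `det(s I - A)`; see `transfer_eq_div`. -/
def numerator {n l : ℕ} (A : Matrix (Fin n) (Fin n) ℝ) (B : Fin n → ℝ)
    (C : Matrix (Fin n) (Fin l) ℝ) (g : Fin l → ℝ) : Polynomial ℝ :=
  (fun i => Polynomial.C (g i)) ⬝ᵥ
    ((C.map Polynomial.C).transpose.mulVec
      (A.charmatrix.adjugate.mulVec (fun i => Polynomial.C (B i))))

/-- `gᵀ χ` is hyper-minimum-phase: its numerator has degree `n - 1` (so `1 ≤ n`), has positive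
coefficients, and is Hurwitz. -/
structure HyperMinimumPhase {n l : ℕ} (A : Matrix (Fin n) (Fin n) ℝ) (B : Fin n → ℝ)
    (C : Matrix (Fin n) (Fin l) ℝ) (g : Fin l → ℝ) : Prop where
  degree_eq : (numerator A B C g).natDegree + 1 = n
  coeff_pos : ∀ i < n, 0 < (numerator A B C g).coeff i
  hurwitz : ∀ s : ℂ, Polynomial.aeval s (numerator A B C g) = 0 → s.re < 0

/-- The number `ϰ₀ = sup_ω Re (-(gᵀ χ(iω))⁻¹)`, over the real `ω` for which `χ(iω)` is defined. -/
def kappaZero {n l : ℕ} (A : Matrix (Fin n) (Fin n) ℝ) (B : Fin n → ℝ)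
    (C : Matrix (Fin n) (Fin l) ℝ) (g : Fin l → ℝ) : ℝ :=
  sSup {x : ℝ | ∃ ω : ℝ, (ω * Complex.I : ℂ) ∉ spectrum ℂ (toComplex A) ∧
    x = (-(transfer A B C g (ω * Complex.I))⁻¹).re}

/-! ### Digraphs and Laplace matrices

In an arc `(i, j)`, that is `G.Adj i j`, the vertex `j` is the parent (neighbour) of `i`. -/

/-- `T` is a directed spanning tree of `G` with root `r`: its arcs are arcs of `G`, the root has no
parent, every other vertex has exactly one parent, and there is a path in `T` from every vertex to
the root. -/
structure IsDirectedSpanningTree {V : Type*} (G T : Digraph V) (r : V) : Prop where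
  arcs : ∀ i j, T.Adj i j → G.Adj i j
  root : ∀ j, ¬ T.Adj r j
  parent : ∀ i, i ≠ r → ∃! j, T.Adj i j
  path : ∀ i, Relation.ReflTransGen T.Adj i r

/-- `G` has at least one directed spanning tree. -/
def HasDirectedSpanningTree {V : Type*} (G : Digraph V) : Prop :=
  ∃ (T : Digraph V) (r : V), IsDirectedSpanningTree G T r

open Classical in
/-- The adjacency matrix of a unit weighted digraph. -/
def adjacency {N : ℕ} (G : Digraph (Fin N)) : Matrix (Fin N) (Fin N) ℝ :=
  Matrix.of fun i j => if G.Adj i j then 1 else 0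

/-- The Laplace matrix `L(G) = diag(𝒜 · 1) - 𝒜`. -/
def laplace {N : ℕ} (G : Digraph (Fin N)) : Matrix (Fin N) (Fin N) ℝ :=
  Matrix.diagonal ((adjacency G).mulVec 1) - adjacency G

/-- `r(M)`: the minimum of the real parts of the nonzero complex eigenvalues of the real
matrix `M`. -/
def minRe {N : ℕ} (M : Matrix (Fin N) (Fin N) ℝ) : ℝ :=
  sInf {x : ℝ | ∃ μ : ℂ, μ ∈ spectrum ℂ (toComplex M) ∧ μ ≠ 0 ∧ x = μ.re}

/-- `v` is a left eigenvector of `M` for the eigenvalue zero, scaled so that `vᵀ · 1 = 1`. -/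
def IsNormalizedLeftNull {N : ℕ} (M : Matrix (Fin N) (Fin N) ℝ) (v : Fin N → ℝ) : Prop :=
  Matrix.vecMul v M = 0 ∧ v ⬝ᵥ 1 = 1

/-! ### The network -/

/-- The output `y = Cᵀ x` of an agent. -/
def output {n l : ℕ} (C : Matrix (Fin n) (Fin l) ℝ) (x : Fin n → ℝ) : Fin l → ℝ :=
  C.transpose.mulVec x

open Classical in
/-- The relative output `∑_{j ∈ 𝒩_i} (y_i - y_j)` of agent `i`, the agents being in the states
`x 1, …, x N`. -/
def relativeOutput {N n l : ℕ} (G : Digraph (Fin N)) (C : Matrix (Fin n) (Fin l) ℝ)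
    (x : Fin N → Fin n → ℝ) (i : Fin N) : Fin l → ℝ :=
  ∑ j ∈ Finset.univ.filter (fun j => G.Adj i j), (output C (x i) - output C (x j))

/-- The static controller `u_i = -k_i gᵀ ȳ_i` with gains `k_i`. -/
def control {N n l : ℕ} (G : Digraph (Fin N)) (C : Matrix (Fin n) (Fin l) ℝ) (g : Fin l → ℝ)
    (gain : Fin N → ℝ) (x : Fin N → Fin n → ℝ) (i : Fin N) : ℝ :=
  -(gain i) * (g ⬝ᵥ relativeOutput G C x i)

/-- `x i t` is the state of agent `i` at time `t`, and on `[0, ∞)` the agents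
`ẋ_i = A x_i + B u_i`, `y_i = Cᵀ x_i` are driven by the static controller with gains `k_i`. -/
def IsTrajectory {N n l : ℕ} (A : Matrix (Fin n) (Fin n) ℝ) (B : Fin n → ℝ)
    (C : Matrix (Fin n) (Fin l) ℝ) (g : Fin l → ℝ) (G : Digraph (Fin N)) (gain : Fin N → ℝ)
    (x : Fin N → ℝ → Fin n → ℝ) : Prop :=
  ∀ i, ∀ t : ℝ, 0 ≤ t →
    HasDerivWithinAt (x i)
      (A.mulVec (x i t) + control G C g gain (fun j => x j t) i • B) (Set.Ici 0) t

/-- The vector `c(t) = exp(A t) (vᵀ ⊗ I_n) x(0)`, where `x(0) = col(x_1(0), …, x_N(0))`, so that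
`(vᵀ ⊗ I_n) x(0) = ∑ i, v_i x_i(0)`. -/
def consensusVector {N n : ℕ} (A : Matrix (Fin n) (Fin n) ℝ) (v : Fin N → ℝ)
    (x₀ : Fin N → Fin n → ℝ) (t : ℝ) : Fin n → ℝ :=
  (NormedSpace.exp (t • A)).mulVec (∑ i, v i • x₀ i)

/-- The transfer function is the quotient of `numerator` by the characteristic polynomial. -/
theorem transfer_eq_div {n l : ℕ} (A : Matrix (Fin n) (Fin n) ℝ) (B : Fin n → ℝ)
    (C : Matrix (Fin n) (Fin l) ℝ) (g : Fin l → ℝ) (s : ℂ) :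
    transfer A B C g s =
      Polynomial.aeval s (numerator A B C g) / Polynomial.aeval s A.charpoly := by
  have hM : A.charmatrix.map (Polynomial.aeval s : Polynomial ℝ →ₐ[ℝ] ℂ) =
      s • (1 : Matrix (Fin n) (Fin n) ℂ) - toComplex A := by
    ext i j
    by_cases h : i = j
    · subst h; simp
    · simp [h]
  have hdet : Polynomial.aeval s A.charpoly =
      (s • (1 : Matrix (Fin n) (Fin n) ℂ) - toComplex A).det := by
    rw [← hM, Matrix.charpoly, AlgHom.map_det]; rfl
  have hadj : ∀ i j, Polynomial.aeval s (A.charmatrix.adjugate i j) =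
      (s • (1 : Matrix (Fin n) (Fin n) ℂ) - toComplex A).adjugate i j := by
    intro i j
    rw [← hM]
    have := AlgHom.map_adjugate (Polynomial.aeval s : Polynomial ℝ →ₐ[ℝ] ℂ) A.charmatrix
    exact congrFun (congrFun this i) j
  rw [hdet]
  simp only [transfer, numerator, Matrix.inv_def, dotProduct, Matrix.mulVec, map_sum, map_mul,
    hadj, Polynomial.aeval_C, Matrix.transpose_apply, Matrix.map_apply, Matrix.smul_apply,
    Ring.inverse_eq_inv', smul_eq_mul, Finset.mul_sum, Finset.sum_div]
  refine Finset.sum_congr rfl fun i _ => Finset.sum_congr rfl fun j _ =>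
    Finset.sum_congr rfl fun k _ => ?_
  simp only [Complex.coe_algebraMap, div_eq_mul_inv]
  ring

end Consensus

end

open Consensus

/-! Write M = K'L, and gᵀχ = β/α with α = det(sI - A). Since vᵀM = 0, the average ∑ v_i x_i moves
freely under A and produces c(t). Since M1 = 0, the deviations δ_i from it obey the network
equation, and they satisfy ∑ v_i δ_i = 0. For such δ the matrix M acts as M + τ 1vᵀ, whose
eigenvalues are τ or nonzero eigenvalues of M (`lt_mul_re_of_vecMul_shifted`). With τ large, every
eigenvalue μ has Re(kμ) > ϰ₀. Combining the δ_i along generalized left eigenvectors leaves systems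
with matrix A - kμ B gᵀCᵀ and vanishing input (`HyperMinimumPhase.tendsto_zero_of_coupled`).

These matrices are Hurwitz: their characteristic polynomial is α + kμβ, and a root in the closed
right half-plane would give kμ = -α/β there. But α/β is s/b plus a proper remainder, with b > 0 the
leading coefficient of β, so Phragmén–Lindelöf carries Re(-α/β) ≤ ϰ₀ from the imaginary axis to the
half-plane (`HyperMinimumPhase.re_neg_div_le_kappaZero`).

On the graph side, a maximum principle along the tree yields v
(`exists_unique_isNormalizedLeftNull`), and Gershgorin discs put the nonzero eigenvalues in Re > 0
(`re_pos_of_mem_spectrum`). -/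

namespace Consensus

/-! ### Stable linear equations with vanishing input. -/

section

/-- A subspace `W` that contains every `w` for which `T w - μ w ∈ W` at some eigenvalue `μ` of `T`
is the whole space. -/
theorem submodule_eq_top_of_forall_eigenvalue {V : Type*} [AddCommGroup V] [Module ℂ V]
    [FiniteDimensional ℂ V] (T : Module.End ℂ V) (W : Submodule ℂ V)
    (h : ∀ μ : ℂ, T.HasEigenvalue μ → ∀ w, T w - μ • w ∈ W → w ∈ W) : W = ⊤ := by
  rw [eq_top_iff, ← Module.End.iSup_maxGenEigenspace_eq_top T, iSup_le_iff]
  intro μ w hw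
  rw [Module.End.mem_maxGenEigenspace] at hw
  obtain ⟨m, hm⟩ := hw
  by_cases hμ : T.HasEigenvalue μ
  · induction m generalizing w with
    | zero => simp only [pow_zero, Module.End.one_apply] at hm; rw [hm]; exact W.zero_mem
    | succ m ih =>
      refine h μ hμ w ?_
      have := ih (w := (T - μ • (1 : Module.End ℂ V)) w) (by
        rwa [pow_succ, Module.End.mul_apply] at hm)
      simpa using this
  · have hinj : Function.Injective (T - μ • (1 : Module.End ℂ V)) := by
      rw [← LinearMap.ker_eq_bot]
      by_contra hne
      exact hμ (by rwa [Module.End.hasEigenvalue_iff, Module.End.eigenspace_def])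
    have : Function.Injective ((T - μ • (1 : Module.End ℂ V)) ^ m) := by
      rw [Module.End.coe_pow]; exact hinj.iterate m
    have : w = 0 := this (by rw [hm, map_zero])
    rw [this]; exact W.zero_mem

/-- A solution of a stable scalar linear equation with vanishing input vanishes at infinity. -/
theorem tendsto_zero_of_scalar_ode {z h : ℝ → ℂ} {lam : ℂ} (hlam : lam.re < 0)
    (hz : ∀ t, 0 ≤ t → HasDerivWithinAt z (lam * z t + h t) (Set.Ici 0) t)
    (hh : Tendsto h atTop (𝓝 0)) : Tendsto z atTop (𝓝 0) := by
  obtain ⟨a, ha⟩ : ∃ a, a = -lam.re := ⟨_, rfl⟩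
  have hapos : 0 < a := by linarith
  have hderiv : ∀ t, 0 ≤ t → HasDerivWithinAt (fun t => Complex.normSq (z t))
      (2 * ((z t).re * (lam * z t + h t).re + (z t).im * (lam * z t + h t).im)) (Set.Ici 0) t := by
    intro t ht
    have h1 := (Complex.reCLM.hasFDerivAt.comp_hasDerivWithinAt t (hz t ht))
    have h2 := (Complex.imCLM.hasFDerivAt.comp_hasDerivWithinAt t (hz t ht))
    have h3 := (h1.mul h1).add (h2.mul h2)
    refine (h3.congr_deriv ?_).congr_of_eventuallyEq ?_ ?_
    · simp; ring
    · exact Eventually.of_forall fun s => by simp [Complex.normSq_apply]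
    · simp [Complex.normSq_apply]
  -- Young's inequality: 2 Re(z̄h) ≤ a|z|² + |h|²/a uses up half of the decay -2a|z|².
  have hle : ∀ t, 2 * ((z t).re * (lam * z t + h t).re + (z t).im * (lam * z t + h t).im) ≤
      -a * Complex.normSq (z t) + Complex.normSq (h t) / a := by
    intro t
    have hre : lam.re = -a := by linarith
    have hc : Complex.normSq (h t) / a = a * ((h t).re / a) ^ 2 + a * ((h t).im / a) ^ 2 := by
      rw [Complex.normSq_apply]; field_simp
    have e1 : (h t).re = a * ((h t).re / a) := by field_simp
    have e2 : (h t).im = a * ((h t).im / a) := by field_simp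
    rw [hc, Complex.normSq_apply]
    simp only [Complex.add_re, Complex.mul_re, Complex.add_im, Complex.mul_im, hre]
    generalize (h t).re / a = p at *
    generalize (h t).im / a = q at *
    rw [e1, e2]
    nlinarith [mul_nonneg hapos.le (sq_nonneg ((z t).re - p)),
      mul_nonneg hapos.le (sq_nonneg ((z t).im - q))]
  have hsq : Tendsto (fun t => Complex.normSq (z t)) atTop (𝓝 0) := by
    rw [Metric.tendsto_atTop]
    intro ε hε
    have hh2 : Tendsto (fun t => Complex.normSq (h t) / a) atTop (𝓝 0) := by
      have := (Complex.continuous_normSq.tendsto 0).comp hh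
      simpa using this.div_const a
    -- With |h|²/a below this level, the stationary value in the Grönwall bound with rate -a is ε/2.
    have hδ : 0 < ε / 2 * a := by positivity
    obtain ⟨T, hT0, hT⟩ : ∃ T : ℝ, 0 ≤ T ∧ ∀ t, T ≤ t → Complex.normSq (h t) / a ≤ ε / 2 * a := by
      obtain ⟨T, hT⟩ := eventually_atTop.1 (hh2.eventually_le_const hδ)
      exact ⟨max T 0, le_max_right _ _, fun t ht => hT t ((le_max_left _ _).trans ht)⟩
    have hexp : Tendsto (fun t => Complex.normSq (z T) * Real.exp (-a * (t - T))) atTop (𝓝 0) := by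
      have h1 : Tendsto (fun t : ℝ => -a * (t - T)) atTop atBot :=
        (tendsto_atTop_add_const_right _ (-T) tendsto_id).const_mul_atTop_of_neg (by linarith)
      simpa using (Real.tendsto_exp_atBot.comp h1).const_mul (Complex.normSq (z T))
    obtain ⟨S, hS⟩ := eventually_atTop.1 (hexp.eventually_lt_const (half_pos hε))
    refine ⟨max S T, fun t ht => ?_⟩
    have htS : S ≤ t := (le_max_left _ _).trans ht
    have htT : T ≤ t := (le_max_right _ _).trans ht
    have key := le_gronwallBound_of_liminf_deriv_right_le
      (f := fun t => Complex.normSq (z t)) (δ := Complex.normSq (z T)) (K := -a)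
      (ε := ε / 2 * a) (a := T) (b := t)
      (f' := fun t => 2 * ((z t).re * (lam * z t + h t).re + (z t).im * (lam * z t + h t).im))
      (fun s hs => ((hderiv s (hT0.trans hs.1)).continuousWithinAt).mono
        (fun u hu => hT0.trans hu.1))
      (fun s hs r hr => ((hderiv s (hT0.trans hs.1)).mono
        (Set.Ici_subset_Ici.2 (hT0.trans hs.1))).liminf_right_slope_le hr)
      le_rfl (fun s hs => (hle s).trans (by have := hT s hs.1; linarith)) t ⟨htT, le_rfl⟩
    rw [gronwallBound_of_K_ne_0 (by linarith)] at key
    have h2 := hS t htS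
    have h3 : ε / 2 * a / -a * (Real.exp (-a * (t - T)) - 1) ≤ ε / 2 := by
      have : ε / 2 * a / -a = -(ε / 2) := by field_simp
      rw [this]
      nlinarith [Real.exp_pos (-a * (t - T))]
    rw [Real.dist_0_eq_abs, abs_of_nonneg (Complex.normSq_nonneg _)]
    simp only at key
    linarith
  rw [tendsto_zero_iff_norm_tendsto_zero]
  have := (Real.continuous_sqrt.tendsto 0).comp hsq
  simpa [Function.comp_def, Complex.norm_def] using this

/-- A solution of a linear system with Hurwitz matrix and vanishing input vanishes at infinity. -/
theorem tendsto_zero_of_hurwitz_ode {m : ℕ} (F : Matrix (Fin m) (Fin m) ℂ)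
    (hF : ∀ s : ℂ, ∀ p : Fin m → ℂ, p ≠ 0 → F.vecMul p = s • p → s.re < 0)
    {y f : ℝ → Fin m → ℂ}
    (hy : ∀ t, 0 ≤ t → HasDerivWithinAt y (F.mulVec (y t) + f t) (Set.Ici 0) t)
    (hf : Tendsto f atTop (𝓝 0)) : Tendsto y atTop (𝓝 0) := by
  -- The functionals that vanish along the solution. If Fᵀp - sp lies in `W`, then p·y solves a
  -- scalar equation with rate s and vanishing input, so p lies in `W`. This replaces a Jordan form.
  let W : Submodule ℂ (Fin m → ℂ) :=
    { carrier := {p | Tendsto (fun t => p ⬝ᵥ y t) atTop (𝓝 0)}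
      add_mem' := fun {p q} hp hq => by
        simpa [add_dotProduct] using Tendsto.add (show Tendsto _ _ _ from hp) hq
      zero_mem' := by simp
      smul_mem' := fun c p hp => by
        simpa [smul_dotProduct] using Tendsto.const_mul c (show Tendsto _ _ _ from hp) }
  have hdot : ∀ (p : Fin m → ℂ) {u : ℝ → Fin m → ℂ}, Tendsto u atTop (𝓝 0) →
      Tendsto (fun t => p ⬝ᵥ u t) atTop (𝓝 0) := by
    intro p u hu
    have : Continuous fun v : Fin m → ℂ => p ⬝ᵥ v := by unfold dotProduct; fun_prop
    simpa [Function.comp_def] using (this.tendsto 0).comp hu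
  have hW : W = ⊤ := by
    refine submodule_eq_top_of_forall_eigenvalue (Matrix.toLin' F.transpose) W ?_
    intro s hs p hp
    obtain ⟨q, hq⟩ := hs.exists_hasEigenvector
    have hsneg : s.re < 0 := hF s q hq.2 (by
      have := hq.apply_eq_smul
      rwa [Matrix.toLin'_apply, Matrix.mulVec_transpose] at this)
    have hp' : Tendsto (fun t => (F.vecMul p - s • p) ⬝ᵥ y t) atTop (𝓝 0) := by
      rw [Matrix.toLin'_apply, Matrix.mulVec_transpose] at hp
      exact hp
    refine tendsto_zero_of_scalar_ode (h := fun t => (F.vecMul p - s • p) ⬝ᵥ y t + p ⬝ᵥ f t)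
      hsneg ?_ (by simpa using hp'.add (hdot p hf))
    intro t ht
    have h1 : HasDerivWithinAt (fun t => p ⬝ᵥ y t) (p ⬝ᵥ (F.mulVec (y t) + f t))
        (Set.Ici 0) t := by
      unfold dotProduct
      refine HasDerivWithinAt.fun_sum fun i _ => ?_
      exact ((hasDerivWithinAt_pi.1 (hy t ht)) i).const_mul (p i)
    refine h1.congr_deriv ?_
    rw [dotProduct_add, Matrix.dotProduct_mulVec, sub_dotProduct, smul_dotProduct, smul_eq_mul]
    ring
  rw [tendsto_pi_nhds]
  intro i
  have : Pi.single i 1 ∈ W := hW ▸ Submodule.mem_top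
  simpa [W] using this

end

/-! ### The bound ϰ₀ on the right half-plane and stability of the closed loop. -/

section

open Polynomial in
/-- A quotient of polynomials `P / Q` with `deg P ≤ deg Q` and without poles in the closed right
half-plane is bounded there. -/
theorem exists_norm_div_le_of_degree_le {P Q : ℂ[X]} (hdeg : P.degree ≤ Q.degree)
    (hQ : ∀ z : ℂ, 0 ≤ z.re → Q.eval z ≠ 0) :
    ∃ K : ℝ, ∀ z : ℂ, 0 ≤ z.re → ‖P.eval z / Q.eval z‖ ≤ K := by
  -- Degree comparison bounds the quotient near infinity; compactness handles the remaining
  -- half-disc.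
  obtain ⟨c, hc⟩ := (Polynomial.isBigO_cobounded_of_degree_le hdeg).bound
  rw [(Metric.hasBasis_cobounded_compl_closedBall (0 : ℂ)).eventually_iff] at hc
  obtain ⟨R, -, hR⟩ := hc
  have hcomp : IsCompact (Metric.closedBall (0 : ℂ) R ∩ {z | 0 ≤ z.re}) :=
    (isCompact_closedBall _ _).inter_right (isClosed_le continuous_const Complex.continuous_re)
  obtain ⟨K, hK⟩ := hcomp.exists_bound_of_continuousOn (f := fun z => P.eval z / Q.eval z)
    (P.continuous.continuousOn.div Q.continuous.continuousOn fun z hz => hQ z hz.2)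
  refine ⟨max c K, fun z hz => ?_⟩
  by_cases h : z ∈ Metric.closedBall (0 : ℂ) R
  · exact (hK z ⟨h, hz⟩).trans (le_max_right _ _)
  · refine le_trans ?_ (le_max_left _ _)
    rw [norm_div, div_le_iff₀ (norm_pos_iff.2 (hQ z hz))]
    exact hR h

open Polynomial in
/-- If `P / Q - a s`, with `a ≥ 0`, is proper and `Q` has no zeros in the closed right half-plane,
then `Re (-P / Q)` is bounded above there. -/
theorem exists_re_neg_div_le {P Q : ℂ[X]} {a : ℝ} (ha : 0 ≤ a)
    (hdeg : (P - C (a : ℂ) * X * Q).degree ≤ Q.degree)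
    (hQ : ∀ z : ℂ, 0 ≤ z.re → Q.eval z ≠ 0) :
    ∃ K : ℝ, ∀ z : ℂ, 0 ≤ z.re → (-(P.eval z / Q.eval z)).re ≤ K := by
  obtain ⟨K, hK⟩ := exists_norm_div_le_of_degree_le hdeg hQ
  refine ⟨K, fun z hz => ?_⟩
  -- The linear part -az has nonpositive real part here, and the remainder is proper, hence bounded.
  have h1 : -(P.eval z / Q.eval z) = -((a : ℂ) * z) +
      -((P - C (a : ℂ) * X * Q).eval z / Q.eval z) := by
    have := hQ z hz
    simp only [eval_sub, eval_mul, eval_C, eval_X]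
    field_simp
    ring
  have h2 := (Complex.abs_re_le_norm (-((P - C (a : ℂ) * X * Q).eval z / Q.eval z))).trans
    ((norm_neg _).trans_le (hK z hz))
  rw [h1, Complex.add_re]
  have h3 : (-((a : ℂ) * z)).re ≤ 0 := by
    simp only [Complex.neg_re, Complex.re_ofReal_mul]
    nlinarith [mul_nonneg ha hz]
  linarith [(abs_le.1 h2).2]

open Polynomial in
/-- Under the conditions of `exists_re_neg_div_le`, a bound for `Re (-P / Q)` on the imaginary axis
holds in the closed right half-plane. -/
theorem re_neg_div_le_of_forall_imaginary {P Q : ℂ[X]} {a κ : ℝ} (ha : 0 ≤ a)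
    (hdeg : (P - C (a : ℂ) * X * Q).degree ≤ Q.degree)
    (hQ : ∀ z : ℂ, 0 ≤ z.re → Q.eval z ≠ 0)
    (hκ : ∀ ω : ℝ, (-(P.eval (ω * Complex.I) / Q.eval (ω * Complex.I))).re ≤ κ)
    {z : ℂ} (hz : 0 ≤ z.re) : (-(P.eval z / Q.eval z)).re ≤ κ := by
  obtain ⟨K, hK⟩ := exists_re_neg_div_le ha hdeg hQ
  have hcl : closure {z : ℂ | 0 < z.re} ⊆ {z | 0 ≤ z.re} :=
    closure_minimal (fun z (hz : 0 < z.re) => hz.le) (isClosed_le continuous_const Complex.continuous_re)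
  have hnorm : ∀ z : ℂ, 0 ≤ z.re → ‖Complex.exp (-(P.eval z / Q.eval z))‖ ≤ Real.exp K := by
    intro z hz
    rw [Complex.norm_exp]
    exact Real.exp_le_exp.2 (hK z hz)
  -- The modulus of exp(-P/Q) is exp(Re(-P/Q)). It is already bounded on the half-plane, so the
  -- growth condition holds with exponent 1 and constant 0.
  have key := PhragmenLindelof.right_half_plane_of_bounded_on_real
    (f := fun z => Complex.exp (-(P.eval z / Q.eval z))) (C := Real.exp κ) (z := z)
    (DifferentiableOn.diffContOnCl fun z hz =>
      ((P.differentiable.differentiableAt.div Q.differentiable.differentiableAt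
        (hQ z (hcl hz))).neg.cexp).differentiableWithinAt)
    ⟨1, by norm_num, 0, Asymptotics.IsBigO.of_bound (Real.exp K) (by
      filter_upwards [mem_inf_of_right (mem_principal_self _)] with z hz
      simpa using hnorm z (le_of_lt hz))⟩
    (isBoundedUnder_of_eventually_le (a := Real.exp K) (by
      filter_upwards [eventually_ge_atTop 0] with x hx
      exact hnorm x (by simpa using hx)))
    (fun ω => by
      rw [Complex.norm_exp]
      exact Real.exp_le_exp.2 (hκ ω)) hz
  rw [Complex.norm_exp] at key
  exact Real.exp_le_exp.1 key

variable {n l : ℕ} {A : Matrix (Fin n) (Fin n) ℝ} {B : Fin n → ℝ}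
  {C : Matrix (Fin n) (Fin l) ℝ} {g : Fin l → ℝ}

-- The characteristic polynomial is monic of degree n and the numerator has degree n - 1, so the
-- coefficient b⁻¹ cancels the leading term. This provides the hypothesis `hdeg` of the half-plane
-- bounds with a = b⁻¹ > 0.
open Polynomial in
theorem HyperMinimumPhase.degree_sub_le (h : HyperMinimumPhase A B C g) :
    (A.charpoly.map (algebraMap ℝ ℂ) - Polynomial.C
      (((numerator A B C g).leadingCoeff⁻¹ : ℝ) : ℂ) * X *
        (numerator A B C g).map (algebraMap ℝ ℂ)).degree ≤
      ((numerator A B C g).map (algebraMap ℝ ℂ)).degree := by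
  set β := numerator A B C g with hβ
  have hb : 0 < β.leadingCoeff := by
    exact h.coeff_pos β.natDegree (by rw [← h.degree_eq]; exact Nat.lt_succ_self _)
  have hβ0 : β ≠ 0 := leadingCoeff_ne_zero.1 hb.ne'
  have hmap : A.charpoly.map (algebraMap ℝ ℂ) - Polynomial.C ((β.leadingCoeff⁻¹ : ℝ) : ℂ) * X *
        β.map (algebraMap ℝ ℂ) =
      (A.charpoly - Polynomial.C (β.leadingCoeff⁻¹) * X * β).map (algebraMap ℝ ℂ) := by
    simp
  rw [hmap, degree_map, degree_map]
  have hdα : A.charpoly.degree = ((β.natDegree + 1 : ℕ) : WithBot ℕ) := by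
    have hn := h.degree_eq
    rw [Matrix.charpoly_degree_eq_dim, Fintype.card_fin, hn]
  have hq : Polynomial.C (β.leadingCoeff⁻¹) * X * β ≠ 0 :=
    mul_ne_zero (mul_ne_zero (C_ne_zero.2 (inv_ne_zero hb.ne')) X_ne_zero) hβ0
  have hdq : (Polynomial.C (β.leadingCoeff⁻¹) * X * β).degree =
      ((β.natDegree + 1 : ℕ) : WithBot ℕ) := by
    rw [degree_mul, degree_C_mul_X (inv_ne_zero hb.ne'), degree_eq_natDegree hβ0, add_comm]
    push_cast; rfl
  have hlt := degree_sub_lt_left (hdα.trans hdq.symm) A.charpoly_monic.ne_zero (by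
    rw [A.charpoly_monic.leadingCoeff]
    simp [leadingCoeff_mul, hb.ne'])
  rw [hdα] at hlt
  rw [degree_eq_natDegree hβ0, degree_le_iff_coeff_zero]
  exact fun m hm => (degree_lt_iff_coeff_zero _ _).1 hlt m (Nat.succ_le_of_lt (by exact_mod_cast hm))

theorem HyperMinimumPhase.aeval_numerator_ne_zero (h : HyperMinimumPhase A B C g) {z : ℂ}
    (hz : 0 ≤ z.re) : Polynomial.aeval z (numerator A B C g) ≠ 0 :=
  fun h0 => absurd (h.hurwitz z h0) (not_lt.2 hz)

theorem charpoly_aeval_eq_det (s : ℂ) : Polynomial.aeval s A.charpoly =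
    (s • (1 : Matrix (Fin n) (Fin n) ℂ) - toComplex A).det := by
  have h := Matrix.eval_charpoly (toComplex A) s
  rw [show (toComplex A).charpoly = A.charpoly.map (algebraMap ℝ ℂ) from
    Matrix.charpoly_map A (algebraMap ℝ ℂ), Polynomial.eval_map_algebraMap] at h
  rw [h, Matrix.scalar_apply, ← Matrix.smul_one_eq_diagonal]

/-- On the closed right half-plane `Re (-(gᵀ χ)⁻¹) ≤ ϰ₀`. -/
theorem HyperMinimumPhase.re_neg_div_le_kappaZero (h : HyperMinimumPhase A B C g) {z : ℂ}
    (hz : 0 ≤ z.re) :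
    (-(Polynomial.aeval z A.charpoly / Polynomial.aeval z (numerator A B C g))).re ≤
      kappaZero A B C g := by
  set β := numerator A B C g with hβ
  have hb : 0 < β.leadingCoeff := by
    exact h.coeff_pos β.natDegree (by rw [← h.degree_eq]; exact Nat.lt_succ_self _)
  have hQ : ∀ z : ℂ, 0 ≤ z.re → (β.map (algebraMap ℝ ℂ)).eval z ≠ 0 := by
    intro z hz
    rw [Polynomial.eval_map_algebraMap]
    exact h.aeval_numerator_ne_zero hz
  have hset : ∀ ω : ℝ, (ω * Complex.I : ℂ) ∉ spectrum ℂ (toComplex A) →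
      (-(Polynomial.aeval (ω * Complex.I : ℂ) A.charpoly /
        Polynomial.aeval (ω * Complex.I : ℂ) β)).re ≤ kappaZero A B C g := by
    intro ω hω
    -- The set must be shown bounded above for its `sSup` to dominate its members.
    refine le_csSup ?_ ⟨ω, hω, ?_⟩
    · obtain ⟨K, hK⟩ := exists_re_neg_div_le (inv_pos.2 hb).le h.degree_sub_le hQ
      refine ⟨K, ?_⟩
      rintro x ⟨ω, -, rfl⟩
      have := hK (ω * Complex.I) (by simp)
      rwa [transfer_eq_div, inv_div, ← Polynomial.eval_map_algebraMap,
        ← Polynomial.eval_map_algebraMap]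
    · rw [transfer_eq_div, inv_div]
  have hcont : Continuous fun ω : ℝ => (-(Polynomial.aeval (ω * Complex.I : ℂ) A.charpoly /
        Polynomial.aeval (ω * Complex.I : ℂ) β)).re := by
    refine Complex.continuous_re.comp (Continuous.neg (Continuous.div ?_ ?_ ?_))
    · exact (Polynomial.continuous_aeval _).comp (by fun_prop)
    · exact (Polynomial.continuous_aeval _).comp (by fun_prop)
    · exact fun ω => h.aeval_numerator_ne_zero (by simp)
  -- Only finitely many frequencies are excluded from the supremum, and α/β is continuous on the
  -- whole axis, so the bound extends by density.
  have hdense : Dense {ω : ℝ | (ω * Complex.I : ℂ) ∉ spectrum ℂ (toComplex A)} := by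
    have hfin : {ω : ℝ | (ω * Complex.I : ℂ) ∈ spectrum ℂ (toComplex A)}.Finite :=
      (Matrix.finite_spectrum (toComplex A)).preimage
        (f := fun ω : ℝ => (ω * Complex.I : ℂ)) fun x _ y _ hxy => by simpa using hxy
    exact hfin.countable.dense_compl ℝ
  have haxis : ∀ ω : ℝ, (-(Polynomial.aeval (ω * Complex.I : ℂ) A.charpoly /
        Polynomial.aeval (ω * Complex.I : ℂ) β)).re ≤ kappaZero A B C g := by
    intro ω
    have := closure_minimal (s := {ω : ℝ | (ω * Complex.I : ℂ) ∉ spectrum ℂ (toComplex A)})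
      (fun ω hω => hset ω hω) (isClosed_le hcont continuous_const)
    exact this (hdense ω)
  have := re_neg_div_le_of_forall_imaginary (inv_pos.2 hb).le h.degree_sub_le hQ
    (κ := kappaZero A B C g) (fun ω => by
      rw [Polynomial.eval_map_algebraMap, Polynomial.eval_map_algebraMap]; exact haxis ω) hz
  rwa [Polynomial.eval_map_algebraMap, Polynomial.eval_map_algebraMap] at this

/-- The state matrix `A - μ B gᵀ Cᵀ` of the system closed by output feedback with the complex
gain `μ`. -/
noncomputable def closedLoop (A : Matrix (Fin n) (Fin n) ℝ) (B : Fin n → ℝ) (C : Matrix (Fin n) (Fin l) ℝ)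
    (g : Fin l → ℝ) (μ : ℂ) : Matrix (Fin n) (Fin n) ℂ :=
  toComplex A - μ • Matrix.vecMulVec (fun i => (B i : ℂ)) (fun i => (C.mulVec g i : ℂ))

/-- The matrix determinant lemma for a rank-one perturbation; it needs the resolvent of A at s. -/
theorem det_closedLoop_of_aeval_charpoly_ne_zero (μ s : ℂ)
    (hs : Polynomial.aeval s A.charpoly ≠ 0) :
    (s • (1 : Matrix (Fin n) (Fin n) ℂ) - closedLoop A B C g μ).det =
      Polynomial.aeval s A.charpoly + μ * Polynomial.aeval s (numerator A B C g) := by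
  have hdet := charpoly_aeval_eq_det (A := A) s
  have hunit : IsUnit (s • (1 : Matrix (Fin n) (Fin n) ℂ) - toComplex A).det := by
    rw [← hdet]; exact isUnit_iff_ne_zero.2 hs
  have hsplit : s • (1 : Matrix (Fin n) (Fin n) ℂ) - closedLoop A B C g μ =
      (s • (1 : Matrix (Fin n) (Fin n) ℂ) - toComplex A) +
        Matrix.replicateCol Unit (μ • fun i => (B i : ℂ)) *
          Matrix.replicateRow Unit (fun i => (C.mulVec g i : ℂ)) := by
    ext i j
    simp [closedLoop, Matrix.mul_apply, Matrix.vecMulVec_apply]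
    ring
  have htr : (Matrix.replicateRow Unit (fun i => (C.mulVec g i : ℂ)) *
      (s • (1 : Matrix (Fin n) (Fin n) ℂ) - toComplex A)⁻¹ *
        Matrix.replicateCol Unit (μ • fun i => (B i : ℂ))) () () =
      μ * transfer A B C g s := by
    have hc : (fun i => (C.mulVec g i : ℂ)) = (toComplex C).mulVec (fun i => (g i : ℂ)) := by
      ext i; simp [Matrix.mulVec, dotProduct]
    rw [Matrix.mul_assoc, ← Matrix.replicateCol_mulVec, Matrix.replicateRow_mul_replicateCol_apply,
      hc, Matrix.mulVec_smul, dotProduct_smul, smul_eq_mul, transfer,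
      Matrix.dotProduct_mulVec _ (toComplex C).transpose, Matrix.vecMul_transpose]
  rw [hsplit, Matrix.det_add_replicateCol_mul_replicateRow hunit,
    Matrix.det_unique (n := Unit), Matrix.add_apply, Matrix.one_apply_eq,
    Subsingleton.elim (default : Unit) (), htr, transfer_eq_div, ← hdet]
  field_simp

-- Both sides are polynomials in s that agree off the spectrum of A. After multiplication by the
-- characteristic polynomial of A they agree everywhere, and that nonzero factor cancels.
open Polynomial in
theorem det_closedLoop (μ s : ℂ) :
    (s • (1 : Matrix (Fin n) (Fin n) ℂ) - closedLoop A B C g μ).det =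
      Polynomial.aeval s A.charpoly + μ * Polynomial.aeval s (numerator A B C g) := by
  have hpoly : A.charpoly.map (algebraMap ℝ ℂ) * ((closedLoop A B C g μ).charpoly -
      (A.charpoly.map (algebraMap ℝ ℂ) +
        Polynomial.C μ * (numerator A B C g).map (algebraMap ℝ ℂ))) = 0 := by
    refine Polynomial.funext fun s => ?_
    by_cases hs : aeval s A.charpoly = 0
    · simp [hs]
    · have := det_closedLoop_of_aeval_charpoly_ne_zero (B := B) (C := C) (g := g) μ s hs
      simp only [eval_mul, eval_sub, eval_add, eval_C, eval_map_algebraMap, Matrix.eval_charpoly,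
        eval_zero, Matrix.scalar_apply, ← Matrix.smul_one_eq_diagonal]
      rw [this]; ring
  have h2 := (mul_eq_zero.1 hpoly).resolve_left (A.charpoly_monic.map _).ne_zero
  have h3 := congrArg (eval s) (sub_eq_zero.1 h2)
  simpa only [eval_mul, eval_add, eval_C, eval_map_algebraMap, Matrix.eval_charpoly,
    Matrix.scalar_apply, ← Matrix.smul_one_eq_diagonal] using h3

/-- The closed loop is stable for every complex gain with real part above `ϰ₀`. -/
theorem HyperMinimumPhase.re_neg_of_closedLoop (h : HyperMinimumPhase A B C g) {μ : ℂ}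
    (hμ : kappaZero A B C g < μ.re) (s : ℂ) (p : Fin n → ℂ) (hp : p ≠ 0)
    (hs : (closedLoop A B C g μ).vecMul p = s • p) : s.re < 0 := by
  by_contra hneg
  have hdet : (s • (1 : Matrix (Fin n) (Fin n) ℂ) - closedLoop A B C g μ).det = 0 := by
    refine Matrix.exists_vecMul_eq_zero_iff.1 ⟨p, hp, ?_⟩
    rw [Matrix.vecMul_sub, hs, Matrix.vecMul_smul, Matrix.vecMul_one, sub_self]
  rw [det_closedLoop] at hdet
  have hβ := h.aeval_numerator_ne_zero (not_lt.1 hneg)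
  have := h.re_neg_div_le_kappaZero (not_lt.1 hneg)
  -- An eigenvalue s in the closed right half-plane forces α(s) + μβ(s) = 0, so μ is a value of -α/β
  -- there.
  have hval : -(Polynomial.aeval s A.charpoly / Polynomial.aeval s (numerator A B C g)) = μ := by
    rw [eq_neg_of_add_eq_zero_left hdet]; field_simp
  rw [hval] at this
  exact absurd hμ (not_lt.2 this)

end

/-! ### Kernel and spectrum of the weighted Laplace matrix. -/

section

variable {N : ℕ} {G : Digraph (Fin N)} {k' : Fin N → ℝ}

open Classical in
theorem adjacency_mulVec (G : Digraph (Fin N)) (u : Fin N → ℝ) (i : Fin N) :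
    (adjacency G).mulVec u i = ∑ j ∈ Finset.univ.filter (fun j => G.Adj i j), u j := by
  simp [adjacency, Matrix.mulVec, dotProduct, Finset.sum_filter]

open Classical in
theorem laplace_mulVec (G : Digraph (Fin N)) (u : Fin N → ℝ) (i : Fin N) :
    (laplace G).mulVec u i = ∑ j ∈ Finset.univ.filter (fun j => G.Adj i j), (u i - u j) := by
  rw [laplace, Matrix.sub_mulVec, Pi.sub_apply, Matrix.mulVec_diagonal, adjacency_mulVec,
    adjacency_mulVec, Finset.sum_sub_distrib, Finset.sum_mul]
  simp

theorem diagonal_mul_laplace_mulVec_one (G : Digraph (Fin N)) (k' : Fin N → ℝ) :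
    (Matrix.diagonal k' * laplace G).mulVec 1 = 0 := by
  ext i
  rw [← Matrix.mulVec_mulVec, Matrix.mulVec_diagonal, laplace_mulVec]
  simp

/-- If the entries of `K' L u` are nonpositive and the graph has a spanning tree with root `r`, then the
maximum of `u` is attained at `r`. -/
theorem le_root_of_diagonal_mul_laplace_mulVec_nonpos {T : Digraph (Fin N)} {r : Fin N}
    (hT : IsDirectedSpanningTree G T r) (hk' : ∀ i, 0 < k' i) {u : Fin N → ℝ}
    (hu : ∀ i, (Matrix.diagonal k' * laplace G).mulVec u i ≤ 0) (i : Fin N) : u i ≤ u r := by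
  classical
  obtain ⟨m, -, hm⟩ := Finset.exists_max_image Finset.univ u ⟨r, Finset.mem_univ r⟩
  -- At a maximum point all differences u p - u j are nonnegative while their sum is not positive,
  -- so all vanish. The maximum thus travels along tree arcs to the root.
  have hstep : ∀ p q, T.Adj p q → u p = u m → u q = u m := by
    intro p q hpq hp
    have h1 := hu p
    rw [← Matrix.mulVec_mulVec, Matrix.mulVec_diagonal, laplace_mulVec] at h1
    have hnn : ∀ j ∈ Finset.univ.filter (fun j => G.Adj p j), 0 ≤ u p - u j := fun j _ => by
      have := hm j (Finset.mem_univ j); rw [hp]; linarith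
    have h2 := Finset.sum_nonneg hnn
    have h3 : ∑ j ∈ Finset.univ.filter (fun j => G.Adj p j), (u p - u j) = 0 := by
      refine le_antisymm ?_ h2
      by_contra hpos
      exact absurd (mul_pos (hk' p) (not_le.1 hpos)) (not_lt.2 h1)
    have h4 := (Finset.sum_eq_zero_iff_of_nonneg hnn).1 h3 q (by simpa using hT.arcs p q hpq)
    linarith
  have hroot : u r = u m := by
    have : ∀ p, Relation.ReflTransGen T.Adj p r → u p = u m → u r = u m := by
      intro p hp
      induction hp using Relation.ReflTransGen.head_induction_on with
      | refl => exact id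
      | head hpq _ ih => exact fun h => ih (hstep _ _ hpq h)
    exact this m (hT.path m) rfl
  rw [hroot]
  exact hm i (Finset.mem_univ i)

/-- If `K' L u` is a constant vector, then `u` is constant and `K' L u = 0`. -/
theorem eq_root_of_diagonal_mul_laplace_mulVec_eq_const {T : Digraph (Fin N)} {r : Fin N}
    (hT : IsDirectedSpanningTree G T r) (hk' : ∀ i, 0 < k' i) {u : Fin N → ℝ} {a : ℝ}
    (hu : ∀ i, (Matrix.diagonal k' * laplace G).mulVec u i = a) :
    a = 0 ∧ ∀ i, u i = u r := by
  classical
  -- K'Lu is nonnegative at a maximum point of u; applying this to u and -u forces a = 0.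
  have hnonpos : ∀ (u : Fin N → ℝ) (a : ℝ),
      (∀ i, (Matrix.diagonal k' * laplace G).mulVec u i = a) → 0 ≤ a := by
    intro u a hu
    obtain ⟨m, -, hm⟩ := Finset.exists_max_image Finset.univ u ⟨r, Finset.mem_univ r⟩
    rw [← hu m, ← Matrix.mulVec_mulVec, Matrix.mulVec_diagonal, laplace_mulVec]
    exact mul_nonneg (hk' m).le (Finset.sum_nonneg fun j _ =>
      sub_nonneg.2 (hm j (Finset.mem_univ j)))
  have hneg : ∀ i, (Matrix.diagonal k' * laplace G).mulVec (-u) i = -a := by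
    intro i; rw [Matrix.mulVec_neg, Pi.neg_apply, hu]
  have ha : a = 0 := le_antisymm (by have := hnonpos _ _ hneg; linarith) (hnonpos _ _ hu)
  refine ⟨ha, fun i => le_antisymm ?_ ?_⟩
  · exact le_root_of_diagonal_mul_laplace_mulVec_nonpos hT hk' (fun i => by rw [hu, ha]) i
  · have := le_root_of_diagonal_mul_laplace_mulVec_nonpos hT hk' (u := -u)
      (fun i => by rw [hneg, ha, neg_zero]) i
    simpa using this

/-- A left null vector of `K' L` with zero coordinate sum vanishes. -/
theorem eq_zero_of_vecMul_eq_zero (hG : HasDirectedSpanningTree G) (hk' : ∀ i, 0 < k' i)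
    {w : Fin N → ℝ} (hw : Matrix.vecMul w (Matrix.diagonal k' * laplace G) = 0)
    (hsum : w ⬝ᵥ 1 = 0) : w = 0 := by
  obtain ⟨T, r, hT⟩ := hG
  by_contra hne
  -- Adding 11ᵀ turns the left null vector w into a right one: some u ≠ 0 has K'Lu constant. Then u
  -- is constant with zero sum, a contradiction.
  have hdet : (Matrix.diagonal k' * laplace G + Matrix.vecMulVec 1 1).det = 0 := by
    refine Matrix.exists_vecMul_eq_zero_iff.1 ⟨w, hne, ?_⟩
    rw [Matrix.vecMul_add, hw, Matrix.vecMul_vecMulVec, hsum, zero_smul, zero_add]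
  obtain ⟨u, hu0, hu⟩ := Matrix.exists_mulVec_eq_zero_iff.2 hdet
  have hu' : ∀ i, (Matrix.diagonal k' * laplace G).mulVec u i = -(1 ⬝ᵥ u) := by
    intro i
    have := congrFun hu i
    rw [Matrix.add_mulVec, Pi.add_apply, Matrix.vecMulVec_mulVec] at this
    simp at this ⊢
    linarith
  obtain ⟨h0, hc⟩ := eq_root_of_diagonal_mul_laplace_mulVec_eq_const hT hk' hu'
  have hNr : (0 : ℝ) < N := by
    have := Fin.pos r
    exact_mod_cast this
  have hr : (N : ℝ) * u r = 0 := by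
    have : (1 : Fin N → ℝ) ⬝ᵥ u = N * u r := by
      rw [one_dotProduct, Finset.sum_congr rfl fun i _ => hc i]; simp
    linarith
  refine hu0 (funext fun i => ?_)
  rw [hc i]
  exact (mul_eq_zero.1 hr).resolve_left hNr.ne'

/-- `K' L` has exactly one left null vector with coordinate sum one. -/
theorem exists_unique_isNormalizedLeftNull (hG : HasDirectedSpanningTree G)
    (hk' : ∀ i, 0 < k' i) :
    ∃ v : Fin N → ℝ, IsNormalizedLeftNull (Matrix.diagonal k' * laplace G) v ∧
      ∀ w, IsNormalizedLeftNull (Matrix.diagonal k' * laplace G) w → w = v := by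
  have hone : (1 : Fin N → ℝ) ≠ 0 := by
    obtain ⟨T, r, -⟩ := hG
    exact fun h => one_ne_zero (congrFun h r)
  obtain ⟨w, hw0, hw⟩ := Matrix.exists_vecMul_eq_zero_iff.2
    (Matrix.exists_mulVec_eq_zero_iff.1 ⟨1, hone, diagonal_mul_laplace_mulVec_one G k'⟩)
  have hs : w ⬝ᵥ 1 ≠ 0 := fun h => hw0 (eq_zero_of_vecMul_eq_zero hG hk' hw h)
  refine ⟨(w ⬝ᵥ 1)⁻¹ • w, ⟨?_, ?_⟩, ?_⟩
  · rw [Matrix.smul_vecMul, hw, smul_zero]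
  · rw [smul_dotProduct, smul_eq_mul, inv_mul_cancel₀ hs]
  · rintro q ⟨hq, hq1⟩
    refine sub_eq_zero.1 (eq_zero_of_vecMul_eq_zero hG hk' ?_ ?_)
    · rw [Matrix.sub_vecMul, hq, Matrix.smul_vecMul, hw, smul_zero, sub_zero]
    · rw [sub_dotProduct, hq1, smul_dotProduct, smul_eq_mul, inv_mul_cancel₀ hs, sub_self]

theorem re_vecMul_toComplex {m : ℕ} (M : Matrix (Fin m) (Fin m) ℝ) (w : Fin m → ℂ) (i : Fin m) :
    ((toComplex M).vecMul w i).re = M.vecMul (fun j => (w j).re) i := by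
  simp [Matrix.vecMul, dotProduct]

theorem im_vecMul_toComplex {m : ℕ} (M : Matrix (Fin m) (Fin m) ℝ) (w : Fin m → ℂ) (i : Fin m) :
    ((toComplex M).vecMul w i).im = M.vecMul (fun j => (w j).im) i := by
  simp [Matrix.vecMul, dotProduct]

/-- A complex left null vector of `K' L` with zero coordinate sum vanishes. -/
theorem eq_zero_of_vecMul_toComplex_eq_zero (hG : HasDirectedSpanningTree G)
    (hk' : ∀ i, 0 < k' i) {w : Fin N → ℂ}
    (hw : (toComplex (Matrix.diagonal k' * laplace G)).vecMul w = 0)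
    (hsum : ∑ i, w i = 0) : w = 0 := by
  have h1 : (fun j => (w j).re) = 0 := by
    refine eq_zero_of_vecMul_eq_zero hG hk' (funext fun i => ?_) ?_
    · rw [← re_vecMul_toComplex, hw]; rfl
    · rw [dotProduct_one, ← Complex.re_sum, hsum, Complex.zero_re]
  have h2 : (fun j => (w j).im) = 0 := by
    refine eq_zero_of_vecMul_eq_zero hG hk' (funext fun i => ?_) ?_
    · rw [← im_vecMul_toComplex, hw]; rfl
    · rw [dotProduct_one, ← Complex.im_sum, hsum, Complex.zero_im]
  exact funext fun i => Complex.ext (congrFun h1 i) (congrFun h2 i)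

/-- The nonzero eigenvalues of `K' L` have positive real parts. -/
theorem re_pos_of_mem_spectrum (hloop : ∀ i, ¬ G.Adj i i) (hk' : ∀ i, 0 < k' i) {μ : ℂ}
    (hμ : μ ∈ spectrum ℂ (toComplex (Matrix.diagonal k' * laplace G))) (hμ0 : μ ≠ 0) :
    0 < μ.re := by
  classical
  rw [← Matrix.spectrum_toLin', ← Module.End.hasEigenvalue_iff_mem_spectrum] at hμ
  -- Rows of K'L sum to zero, so each Gershgorin disc has center and radius ρ ≥ 0 and touches the
  -- imaginary axis only at 0: |μ|² ≤ 2ρ Re μ.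
  obtain ⟨i, hi⟩ := eigenvalue_mem_ball hμ
  have hd : (adjacency G).mulVec 1 i = ∑ j ∈ Finset.univ.erase i, adjacency G i j := by
    rw [Matrix.mulVec, dotProduct_one, ← Finset.add_sum_erase _ _ (Finset.mem_univ i)]
    simp [adjacency, hloop i]
  have hnn : ∀ j, 0 ≤ adjacency G i j := fun j => by
    simp only [adjacency, Matrix.of_apply]; split_ifs <;> norm_num
  have hii : toComplex (Matrix.diagonal k' * laplace G) i i =
      ((k' i * ∑ j ∈ Finset.univ.erase i, adjacency G i j : ℝ) : ℂ) := by
    rw [toComplex, Matrix.map_apply, Matrix.diagonal_mul, laplace, Matrix.sub_apply,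
      Matrix.diagonal_apply_eq, hd]
    simp [adjacency, hloop i]
  have hij : ∑ j ∈ Finset.univ.erase i, ‖toComplex (Matrix.diagonal k' * laplace G) i j‖ =
      k' i * ∑ j ∈ Finset.univ.erase i, adjacency G i j := by
    rw [Finset.mul_sum]
    refine Finset.sum_congr rfl fun j hj => ?_
    rw [toComplex, Matrix.map_apply, Matrix.diagonal_mul, laplace, Matrix.sub_apply,
      Matrix.diagonal_apply_ne _ (Finset.ne_of_mem_erase hj).symm, zero_sub, Complex.norm_real,
      Real.norm_eq_abs, mul_neg, abs_neg, abs_of_nonneg (mul_nonneg (hk' i).le (hnn j))]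
  rw [hii, hij, Metric.mem_closedBall, dist_eq_norm] at hi
  obtain ⟨ρ, hρ⟩ : ∃ ρ, ρ = k' i * ∑ j ∈ Finset.univ.erase i, adjacency G i j := ⟨_, rfl⟩
  rw [← hρ] at hi
  have h2 : Complex.normSq (μ - ρ) ≤ ρ ^ 2 := by
    rw [Complex.normSq_eq_norm_sq]
    exact pow_le_pow_left₀ (norm_nonneg _) hi 2
  have h3 : 0 < Complex.normSq μ := Complex.normSq_pos.2 hμ0
  have hρ0 : 0 ≤ ρ := (norm_nonneg _).trans hi
  rw [Complex.normSq_apply] at h2 h3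
  simp at h2
  by_contra hneg
  nlinarith [mul_nonneg hρ0 (neg_nonneg.2 (not_lt.1 hneg))]

/-- The gain condition of the synchronization theorem, eigenvalue by eigenvalue. -/
theorem lt_mul_re_of_div_minRe_lt {κ k : ℝ} (hk : 0 < k) (M : Matrix (Fin N) (Fin N) ℝ)
    (hM : ∀ μ ∈ spectrum ℂ (toComplex M), μ ≠ 0 → 0 < μ.re)
    (hgain : κ / minRe M < k) {μ : ℂ} (hμ : μ ∈ spectrum ℂ (toComplex M)) (hμ0 : μ ≠ 0) :
    κ < k * μ.re := by
  have hfin : {x : ℝ | ∃ μ : ℂ, μ ∈ spectrum ℂ (toComplex M) ∧ μ ≠ 0 ∧ x = μ.re}.Finite :=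
    ((Matrix.finite_spectrum (toComplex M)).image Complex.re).subset (by
      rintro x ⟨μ, h, -, rfl⟩; exact ⟨μ, h, rfl⟩)
  have hle : minRe M ≤ μ.re := csInf_le hfin.bddBelow ⟨μ, hμ, hμ0, rfl⟩
  have hne : {x : ℝ | ∃ μ : ℂ, μ ∈ spectrum ℂ (toComplex M) ∧ μ ≠ 0 ∧ x = μ.re}.Nonempty :=
    ⟨μ.re, μ, hμ, hμ0, rfl⟩
  -- The set is finite and contains Re μ, so its infimum is attained and hence positive.
  obtain ⟨ν, hν, hν0, hmin⟩ := hne.csInf_mem hfin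
  have hpos : 0 < minRe M := by
    rw [minRe, hmin]; exact hM ν hν hν0
  have h1 : κ < k * minRe M := (div_lt_iff₀ hpos).1 hgain
  exact h1.trans_le (mul_le_mul_of_nonneg_left hle hk.le)

end

/-! ### Coupled agents and the free motion. -/

section

variable {N n l : ℕ} {A : Matrix (Fin n) (Fin n) ℝ} {B : Fin n → ℝ}
  {C : Matrix (Fin n) (Fin l) ℝ} {g : Fin l → ℝ}

/-- If every eigenvalue `μ` of the coupling matrix `T` satisfies `Re (k μ) > ϰ₀`, then the states
of the coupled agents vanish at infinity. -/
theorem HyperMinimumPhase.tendsto_zero_of_coupled (h : HyperMinimumPhase A B C g) (k : ℝ)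
    (T : Matrix (Fin N) (Fin N) ℂ)
    (hT : ∀ (μ : ℂ) (p : Fin N → ℂ), p ≠ 0 → T.vecMul p = μ • p →
      kappaZero A B C g < (k * μ).re)
    {d : Fin N → ℝ → Fin n → ℂ}
    (hd : ∀ i, ∀ t : ℝ, 0 ≤ t → HasDerivWithinAt (d i)
      ((toComplex A).mulVec (d i t) -
        (k * ∑ j, T i j * ((fun m => (C.mulVec g m : ℂ)) ⬝ᵥ d j t)) • fun m => (B m : ℂ))
      (Set.Ici 0) t) (i : Fin N) :
    Tendsto (d i) atTop (𝓝 0) := by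
  set c : Fin n → ℂ := fun m => (C.mulVec g m : ℂ) with hc
  set b : Fin n → ℂ := fun m => (B m : ℂ) with hb
  -- Weights whose combination of states vanishes at infinity. If Tᵀw - μw lies in `W`, the
  -- combination with weights w obeys the closed loop with gain kμ and vanishing input.
  let W : Submodule ℂ (Fin N → ℂ) :=
    { carrier := {w | Tendsto (fun t => ∑ i, w i • d i t) atTop (𝓝 0)}
      add_mem' := fun {p q} hp hq => by
        simpa [add_smul, Finset.sum_add_distrib] using
          Tendsto.add (show Tendsto _ _ _ from hp) hq
      zero_mem' := by simp
      smul_mem' := fun a p hp => by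
        simpa [Finset.smul_sum, smul_smul] using
          Tendsto.const_smul (show Tendsto _ _ _ from hp) a }
  have hW : W = ⊤ := by
    refine submodule_eq_top_of_forall_eigenvalue (Matrix.toLin' T.transpose) W ?_
    intro μ hμ w hw
    obtain ⟨q, hq⟩ := hμ.exists_hasEigenvector
    have hκ := hT μ q hq.2 (by
      have := hq.apply_eq_smul
      rwa [Matrix.toLin'_apply, Matrix.mulVec_transpose] at this)
    have hw' : Tendsto (fun t => ∑ j, (T.vecMul w - μ • w) j • d j t) atTop (𝓝 0) := by
      rw [Matrix.toLin'_apply, Matrix.mulVec_transpose] at hw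
      exact hw
    refine tendsto_zero_of_hurwitz_ode (closedLoop A B C g (k * μ))
      (h.re_neg_of_closedLoop hκ)
      (f := fun t => (-(k * (c ⬝ᵥ ∑ j, (T.vecMul w - μ • w) j • d j t))) • b) ?_ ?_
    · intro t ht
      have h1 : HasDerivWithinAt (fun t => ∑ i, w i • d i t)
          (∑ i, w i • ((toComplex A).mulVec (d i t) - (k * ∑ j, T i j * (c ⬝ᵥ d j t)) • b))
          (Set.Ici 0) t :=
        HasDerivWithinAt.fun_sum fun i _ => (hd i t ht).const_smul (w i)
      refine h1.congr_deriv ?_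
      have e1 : ∑ i, w i • ((toComplex A).mulVec (d i t) - (k * ∑ j, T i j * (c ⬝ᵥ d j t)) • b) =
          (toComplex A).mulVec (∑ i, w i • d i t) -
            (k * ∑ j, T.vecMul w j * (c ⬝ᵥ d j t)) • b := by
        simp only [smul_sub, Finset.sum_sub_distrib, smul_smul, ← Finset.sum_smul,
          Matrix.mulVec_sum, Matrix.mulVec_smul]
        congr 2
        simp only [Matrix.vecMul, dotProduct, Finset.sum_mul, Finset.mul_sum]
        rw [Finset.sum_comm]
        refine Finset.sum_congr rfl fun j _ => ?_
        rw [Finset.sum_comm]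
        exact Finset.sum_congr rfl fun m _ => Finset.sum_congr rfl fun i _ => by ring
      have e2 : (closedLoop A B C g (k * μ)).mulVec (∑ i, w i • d i t) =
          (toComplex A).mulVec (∑ i, w i • d i t) -
            (k * μ * (c ⬝ᵥ ∑ i, w i • d i t)) • b := by
        rw [closedLoop, Matrix.sub_mulVec, Matrix.smul_mulVec, Matrix.vecMulVec_mulVec]
        ext m
        simp [hc, hb]
        ring
      rw [e1, e2, sub_add, ← sub_smul]
      congr 2
      simp only [dotProduct_sum, dotProduct_smul, Pi.sub_apply, Pi.smul_apply, sub_smul,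
        dotProduct_sub, Finset.sum_sub_distrib, smul_eq_mul, mul_assoc,
        ← Finset.mul_sum]
      ring
    · have hcont : Continuous fun u : Fin n → ℂ => (-(k * (c ⬝ᵥ u))) • b := by
        unfold dotProduct; fun_prop
      simpa [Function.comp_def] using (hcont.tendsto 0).comp hw'
  have : Pi.single i 1 ∈ W := hW ▸ Submodule.mem_top
  simpa [W, Pi.single_apply] using this

/-- The controller in terms of the Laplace matrix. -/
theorem control_eq (G : Digraph (Fin N)) (k : ℝ) (k' : Fin N → ℝ) (x : Fin N → Fin n → ℝ)
    (i : Fin N) :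
    control G C g (fun i => k * k' i) x i =
      -(k * (Matrix.diagonal k' * laplace G).mulVec (fun j => C.mulVec g ⬝ᵥ x j) i) := by
  have hout : ∀ y : Fin n → ℝ, g ⬝ᵥ output C y = C.mulVec g ⬝ᵥ y := fun y => by
    rw [output, Matrix.dotProduct_mulVec, Matrix.vecMul_transpose]
  rw [control, relativeOutput, dotProduct_sum, ← Matrix.mulVec_mulVec, Matrix.mulVec_diagonal,
    laplace_mulVec]
  simp only [dotProduct_sub, hout]
  ring

/-- A solution of `ẏ = A y` on `[0, ∞)` is `exp (A t) y(0)`. -/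
theorem eq_exp_mulVec_of_linear_ode {y : ℝ → Fin n → ℝ}
    (hy : ∀ t, 0 ≤ t → HasDerivWithinAt y (A.mulVec (y t)) (Set.Ici 0) t) {t : ℝ} (ht : 0 ≤ t) :
    y t = (NormedSpace.exp (t • A)).mulVec (y 0) := by
  let : NormedRing (Matrix (Fin n) (Fin n) ℝ) := Matrix.linftyOpNormedRing
  let : NormedAlgebra ℝ (Matrix (Fin n) (Fin n) ℝ) := Matrix.linftyOpNormedAlgebra
  have hexp : ∀ s : ℝ, HasDerivAt (fun s : ℝ => (NormedSpace.exp (s • A)).mulVec (y 0))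
      (A.mulVec ((NormedSpace.exp (s • A)).mulVec (y 0))) s := by
    intro s
    have h1 := hasDerivAt_exp_smul_const' (𝕂 := ℝ) A s
    let Φ : Matrix (Fin n) (Fin n) ℝ →ₗ[ℝ] Fin n → ℝ :=
      (Matrix.mulVecBilin ℝ ℝ).flip (y 0)
    have h2 := (LinearMap.toContinuousLinearMap Φ).hasFDerivAt.comp_hasDerivAt s h1
    rw [Matrix.mulVec_mulVec]
    exact h2
  have hlip : LipschitzWith ‖LinearMap.toContinuousLinearMap (Matrix.toLin' A)‖₊
      (fun u : Fin n → ℝ => A.mulVec u) :=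
    (LinearMap.toContinuousLinearMap (Matrix.toLin' A)).lipschitz
  refine ODE_solution_unique (v := fun _ u => A.mulVec u) (a := 0) (b := t) (fun _ => hlip)
    (fun s hs => (hy s hs.1).continuousWithinAt.mono fun u hu => hu.1)
    (fun s hs => (hy s hs.1).mono (Set.Ici_subset_Ici.2 hs.1))
    (fun s _ => (hexp s).continuousAt.continuousWithinAt)
    (fun s _ => (hexp s).hasDerivWithinAt) ?_ ⟨ht, le_rfl⟩
  simp

end

/-! ### Deviations from the weighted average, and the theorem. -/

section

variable {N n l : ℕ} {A : Matrix (Fin n) (Fin n) ℝ} {B : Fin n → ℝ}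
  {C : Matrix (Fin n) (Fin l) ℝ} {g : Fin l → ℝ} {G : Digraph (Fin N)} {k' : Fin N → ℝ}

/-- Replacing the zero eigenvalue of `K' L` by `τ` leaves only eigenvalues that satisfy the gain
condition. -/
theorem lt_mul_re_of_vecMul_shifted (hG : HasDirectedSpanningTree G) (hk' : ∀ i, 0 < k' i)
    {v : Fin N → ℝ} (hv : IsNormalizedLeftNull (Matrix.diagonal k' * laplace G) v)
    {κ k τ : ℝ} (hτ : κ < k * τ)
    (hM : ∀ μ ∈ spectrum ℂ (toComplex (Matrix.diagonal k' * laplace G)), μ ≠ 0 → κ < k * μ.re)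
    (μ : ℂ) (p : Fin N → ℂ) (hp : p ≠ 0)
    (hμ : (toComplex (Matrix.diagonal k' * laplace G) +
      (τ : ℂ) • Matrix.vecMulVec 1 (fun i => (v i : ℂ))).vecMul p = μ • p) :
    κ < (k * μ).re := by
  set M := Matrix.diagonal k' * laplace G with hMdef
  rw [Matrix.vecMul_add, Matrix.vecMul_smul, Matrix.vecMul_vecMulVec] at hμ
  have hone : (toComplex M).mulVec 1 = 0 := by
    ext i
    have := congrFun (diagonal_mul_laplace_mulVec_one G k') i
    simp only [Matrix.mulVec, dotProduct_one, ← hMdef, Pi.zero_apply] at this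
    simp only [Matrix.mulVec, dotProduct_one, toComplex, Matrix.map_apply, Pi.zero_apply]
    exact_mod_cast this
  have hv1 : (fun i => (v i : ℂ)) ⬝ᵥ 1 = 1 := by
    have := hv.2
    rw [dotProduct_one] at this ⊢
    exact_mod_cast this
  -- Pairing with 1 gives τ(p·1) = μ(p·1). Either μ = τ, or p·1 = 0 and p is a left eigenvector of
  -- M, whose eigenvalue is nonzero because a null vector with zero sum vanishes.
  have hsum := congrArg (· ⬝ᵥ (1 : Fin N → ℂ)) hμ
  simp only [add_dotProduct, smul_dotProduct, ← Matrix.dotProduct_mulVec, hone, hv1,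
    dotProduct_zero, smul_eq_mul, zero_add, mul_one] at hsum
  rw [Complex.re_ofReal_mul]
  by_cases hp1 : p ⬝ᵥ (1 : Fin N → ℂ) = 0
  · rw [hp1, zero_smul, smul_zero, add_zero] at hμ
    refine hM μ ?_ ?_
    · rw [spectrum.mem_iff, Algebra.algebraMap_eq_smul_one, Matrix.isUnit_iff_isUnit_det,
        isUnit_iff_ne_zero, not_not]
      refine Matrix.exists_vecMul_eq_zero_iff.1 ⟨p, hp, ?_⟩
      rw [Matrix.vecMul_sub, hμ, Matrix.vecMul_smul, Matrix.vecMul_one, sub_self]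
    · rintro rfl
      rw [zero_smul] at hμ
      exact hp (eq_zero_of_vecMul_toComplex_eq_zero hG hk' hμ (by rwa [dotProduct_one] at hp1))
  · rw [← mul_right_cancel₀ hp1 hsum]
    exact hτ

theorem vecMul_dotProduct_of_isNormalizedLeftNull {M : Matrix (Fin N) (Fin N) ℝ} {v : Fin N → ℝ}
    (hv : IsNormalizedLeftNull M v) (s : Fin N → ℝ) : ∑ i, v i * M.mulVec s i = 0 := by
  have : v ⬝ᵥ M.mulVec s = 0 := by rw [Matrix.dotProduct_mulVec, hv.1, zero_dotProduct]
  exact this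

/-- The weighted average of the states of the network moves freely. -/
theorem IsTrajectory.hasDerivWithinAt_average {k : ℝ} {x : Fin N → ℝ → Fin n → ℝ}
    (hx : IsTrajectory A B C g G (fun i => k * k' i) x) {v : Fin N → ℝ}
    (hv : IsNormalizedLeftNull (Matrix.diagonal k' * laplace G) v) (t : ℝ) (ht : 0 ≤ t) :
    HasDerivWithinAt (fun t => ∑ i, v i • x i t) (A.mulVec (∑ i, v i • x i t)) (Set.Ici 0) t := by
  refine (HasDerivWithinAt.fun_sum fun i _ => (hx i t ht).const_smul (v i)).congr_deriv ?_
  simp only [smul_add, Finset.sum_add_distrib, smul_smul, ← Finset.sum_smul, Matrix.mulVec_sum,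
    Matrix.mulVec_smul, control_eq]
  -- The weighted inputs cancel because v is a left null vector.
  have h0 := vecMul_dotProduct_of_isNormalizedLeftNull hv (fun j => C.mulVec g ⬝ᵥ x j t)
  have : ∑ i, v i * -(k * (Matrix.diagonal k' * laplace G).mulVec
      (fun j => C.mulVec g ⬝ᵥ x j t) i) = 0 := by
    rw [← neg_eq_zero, ← mul_eq_zero_of_right k h0, Finset.mul_sum, ← Finset.sum_neg_distrib]
    exact Finset.sum_congr rfl fun i _ => by ring
  rw [this, zero_smul, add_zero]

/-- The states of the network approach their weighted average. -/
theorem IsTrajectory.tendsto_sub_average (h : HyperMinimumPhase A B C g)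
    (hloop : ∀ i, ¬ G.Adj i i) (hG : HasDirectedSpanningTree G) {k : ℝ} (hk : 0 < k)
    (hk' : ∀ i, 0 < k' i)
    (hgain : kappaZero A B C g / minRe (Matrix.diagonal k' * laplace G) < k)
    {x : Fin N → ℝ → Fin n → ℝ} (hx : IsTrajectory A B C g G (fun i => k * k' i) x)
    {v : Fin N → ℝ} (hv : IsNormalizedLeftNull (Matrix.diagonal k' * laplace G) v) (i : Fin N) :
    Tendsto (fun t => x i t - ∑ j, v j • x j t) atTop (𝓝 0) := by
  set M := Matrix.diagonal k' * laplace G with hMdef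
  set κ := kappaZero A B C g with hκ
  -- The value of τ is otherwise free: the term τ 1vᵀ does not act on the deviations, since ∑ v_j
  -- δ_j = 0.
  obtain ⟨τ, hτ⟩ : ∃ τ : ℝ, κ < k * τ :=
    ⟨(κ + 1) / k, by rw [mul_div_cancel₀ _ hk.ne']; linarith⟩
  have hM : ∀ μ ∈ spectrum ℂ (toComplex M), μ ≠ 0 → κ < k * μ.re := fun μ hμ hμ0 =>
    lt_mul_re_of_div_minRe_lt hk M (fun μ => re_pos_of_mem_spectrum hloop hk') hgain hμ hμ0
  let δ : Fin N → ℝ → Fin n → ℝ := fun i t => x i t - ∑ j, v j • x j t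
  have hδsum : ∀ t, ∑ i, v i • δ i t = 0 := by
    intro t
    have h1 : ∑ i, v i = 1 := by rw [← dotProduct_one]; exact hv.2
    simp only [δ, smul_sub, Finset.sum_sub_distrib, ← Finset.sum_smul, h1, one_smul, sub_self]
  have hδ : ∀ i, ∀ t : ℝ, 0 ≤ t → HasDerivWithinAt (δ i)
      (A.mulVec (δ i t) - (k * M.mulVec (fun j => C.mulVec g ⬝ᵥ δ j t) i) • B) (Set.Ici 0) t := by
    intro i t ht
    refine ((hx i t ht).sub (hx.hasDerivWithinAt_average hv t ht)).congr_deriv ?_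
    -- Subtracting the average changes the scalar outputs by a multiple of 1, which M annihilates.
    have hs : (fun j => C.mulVec g ⬝ᵥ δ j t) = (fun j => C.mulVec g ⬝ᵥ x j t) -
        (C.mulVec g ⬝ᵥ ∑ j, v j • x j t) • (1 : Fin N → ℝ) := by
      ext j; simp [δ, dotProduct_sub]
    have hMs : M.mulVec (fun j => C.mulVec g ⬝ᵥ δ j t) =
        M.mulVec (fun j => C.mulVec g ⬝ᵥ x j t) := by
      rw [hs, Matrix.mulVec_sub, Matrix.mulVec_smul, diagonal_mul_laplace_mulVec_one, smul_zero,
        sub_zero]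
    rw [hMs, control_eq, Matrix.mulVec_sub, neg_smul]
    abel
  have hδC : ∀ i, ∀ t : ℝ, 0 ≤ t → HasDerivWithinAt (fun t m => (δ i t m : ℂ))
      ((toComplex A).mulVec (fun m => (δ i t m : ℂ)) - (k * ∑ j, (toComplex M +
        (τ : ℂ) • Matrix.vecMulVec 1 (fun i => (v i : ℂ)) : Matrix (Fin N) (Fin N) ℂ) i j *
          ((fun m => (C.mulVec g m : ℂ)) ⬝ᵥ fun m => (δ j t m : ℂ))) • fun m => (B m : ℂ))
      (Set.Ici 0) t := by
    intro i t ht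
    rw [hasDerivWithinAt_pi]
    intro m
    have h1 := (hasDerivWithinAt_pi.1 (hδ i t ht) m).ofReal_comp
    refine h1.congr_deriv ?_
    have hzero : ∑ j, (v j : ℂ) *
        ((fun m => (C.mulVec g m : ℂ)) ⬝ᵥ fun m => (δ j t m : ℂ)) = 0 := by
      have := congrArg (C.mulVec g ⬝ᵥ ·) (hδsum t)
      simp only [dotProduct_sum, dotProduct_smul, dotProduct_zero, smul_eq_mul] at this
      simp only [dotProduct] at this ⊢
      exact_mod_cast this
    have hsplit : ∑ j, (toComplex M +
        (τ : ℂ) • Matrix.vecMulVec 1 (fun i => (v i : ℂ)) : Matrix (Fin N) (Fin N) ℂ) i j *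
          ((fun m => (C.mulVec g m : ℂ)) ⬝ᵥ fun m => (δ j t m : ℂ)) =
        ∑ j, (M i j : ℂ) * ((fun m => (C.mulVec g m : ℂ)) ⬝ᵥ fun m => (δ j t m : ℂ)) := by
      simp only [Matrix.add_apply, Matrix.smul_apply, Matrix.vecMulVec_apply, Pi.one_apply,
        one_mul, smul_eq_mul, add_mul, Finset.sum_add_distrib, mul_assoc, ← Finset.mul_sum, hzero,
        mul_zero, add_zero, toComplex, Matrix.map_apply]
    rw [hsplit]
    simp [Matrix.mulVec, dotProduct]
  have hlim := h.tendsto_zero_of_coupled k _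
    (lt_mul_re_of_vecMul_shifted hG hk' hv hτ hM) hδC i
  rw [tendsto_pi_nhds] at hlim ⊢
  intro m
  have := (Complex.continuous_re.tendsto 0).comp (hlim m)
  simpa [Function.comp_def, δ] using this

end

end Consensus

open Consensus
-- For N = 1 the set defining `minRe` is empty, its `sInf` is 0, and division by zero gives 0, so
-- `hgain` reads 0 < k.
theorem mainTheorem6 {N n l : ℕ}
    (A : Matrix (Fin n) (Fin n) ℝ) (B : Fin n → ℝ) (C : Matrix (Fin n) (Fin l) ℝ)
    (g : Fin l → ℝ) (hA1 : HyperMinimumPhase A B C g)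
    (G : Digraph (Fin N)) (hloop : ∀ i, ¬ G.Adj i i) (hA2 : HasDirectedSpanningTree G)
    (k : ℝ) (k' : Fin N → ℝ) (hk : 0 < k) (hk' : ∀ i, 0 < k' i)
    (hsphere : ∑ i, (k' i) ^ 2 = 1)
    (hgain : kappaZero A B C g / minRe (Matrix.diagonal k' * laplace G) < k) :
    ∃ v : Fin N → ℝ,
      IsNormalizedLeftNull (Matrix.diagonal k' * laplace G) v ∧
      (∀ w, IsNormalizedLeftNull (Matrix.diagonal k' * laplace G) w → w = v) ∧
      ∀ x : Fin N → ℝ → Fin n → ℝ,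
        IsTrajectory A B C g G (fun i => k * k' i) x →
          (∀ i j, Tendsto (fun t => x i t - x j t) atTop (𝓝 0)) ∧
          ∀ i, Tendsto (fun t => x i t - consensusVector A v (fun j => x j 0) t) atTop (𝓝 0) := by
  obtain ⟨v, hv, huniq⟩ := exists_unique_isNormalizedLeftNull hA2 hk'
  refine ⟨v, hv, huniq, fun x hx => ?_⟩
  have hlim := fun i => hx.tendsto_sub_average hA1 hloop hA2 hk hk' hgain hv i
  refine ⟨fun i j => ?_, fun i => ?_⟩
  · simpa using (hlim i).sub (hlim j)
  -- The average equals c(t) only for t ≥ 0, which suffices for the limit.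
  · refine (hlim i).congr' ?_
    filter_upwards [eventually_ge_atTop 0] with t ht
    rw [consensusVector]
    congr 1
    exact eq_exp_mulVec_of_linear_ode (hx.hasDerivWithinAt_average hv) ht
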